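/- Let $k$ be a field, let $F$ be a free group on a finite alphabet, and let $kF$ be the group algebra of $F$ over $k$. For $v\in kF$, let $\operatorname{supp}(v)\subseteq F$ be the set of elements of $F$ that appear in $v$ with nonzero coefficient. Let $u\in kF\setminus k$, let $C=\{v\in kF : uv=vu\}$ be the centralizer of $u$ in $kF$, and let $$H=\Big\langle \bigcup_{v\in C}\operatorname{supp}(v)\Big\rangle\le F$$ be the subgroup of $F$ generated by the supports of all elements of $C$. Then $H$ is finitely generated. Moreover, the image of $\operatorname{supp}(u)$ (which is contained in $H$) in the abelianization $H^{\mathrm{ab}}$ of $H$ generates a subgroup of $H^{\mathrm{ab}}$ whose rank equals the rank of $H$. Here the rank of the free group $H$ is the cardinality of a free basis of $H$, and the rank of an abelian group is the maximal number of $\mathbb{Z}$-linearly independent elements in it. -/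

import Mathlib

universe u v

/-- The support of an element of a group algebra `k[G]`: the set of group elements that appear
in it with a nonzero coefficient. -/
def gaSupp {k : Type v} {G : Type u} [Field k] [Group G] (x : MonoidAlgebra k G) : Set G :=
  {g : G | x.coeff g ≠ 0}

/-- The centralizer-supporting group of `x ∈ k[G]`: the subgroup of `G` generated by the union of
the supports of all elements of the centralizer of `x` in `k[G]`. -/
def centralizerSupportingGroup {k : Type v} {G : Type u} [Field k] [Group G]
    (x : MonoidAlgebra k G) : Subgroup G :=
  Subgroup.closure (⋃ y ∈ Subalgebra.centralizer k {x}, gaSupp y)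

/-- An element of the group algebra is supported on its centralizer-supporting group. -/
theorem mem_centralizerSupportingGroup_of_mem_gaSupp {k : Type v} {G : Type u} [Field k] [Group G]
    (x : MonoidAlgebra k G) {g : G} (hg : g ∈ gaSupp x) :
    g ∈ centralizerSupportingGroup x := by
  refine Subgroup.subset_closure (Set.mem_iUnion₂.mpr ⟨x, ?_, hg⟩)
  rw [Subalgebra.mem_centralizer_iff]
  rintro z rfl
  rfl

/-- The image of the support of `x` in the abelianization of its centralizer-supporting group. -/
def gaSuppAbImage {k : Type v} {G : Type u} [Field k] [Group G] (x : MonoidAlgebra k G) :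
    Set (Abelianization (centralizerSupportingGroup x)) :=
  {a | ∃ (g : G) (hg : g ∈ gaSupp x),
    a = Abelianization.of ⟨g, mem_centralizerSupportingGroup_of_mem_gaSupp x hg⟩}

/-- The rank of a free group: the cardinality of a free basis. -/
noncomputable def freeGroupRank (G : Type u) [Group G] [IsFreeGroup G] : Cardinal.{u} :=
  Cardinal.mk (IsFreeGroup.Generators G)

/-- The rank of a free group does not depend on the choice of the free basis. -/
theorem freeGroupRank_eq {G : Type u} [Group G] [IsFreeGroup G] {ι : Type u}
    (b : FreeGroupBasis ι G) : freeGroupRank G = Cardinal.mk ι :=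
  Cardinal.mk_congr (Equiv.ofFreeGroupEquiv ((IsFreeGroup.mulEquiv G).trans b.repr))

/-- The rank of an abelian group (written multiplicatively): its rank as a `ℤ`-module, that is,
the supremum of the cardinalities of its `ℤ`-linearly independent subsets. -/
noncomputable def abelianGroupRank (A : Type u) [CommGroup A] : Cardinal.{u} :=
  Module.rank ℤ (Additive A)

/-!
Write `H` for the centralizer-supporting group of `x`. It is free, by the Nielsen–Schreier theorem.
Both claims follow once every homomorphism `φ : H → ℤ` that kills the support of `x` is trivial
(`IsFreeGroup.fg_and_abelianGroupRank_eq`): a basis element of `H` that occurs in no element of the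
finite set `supp x` modulo commutators would give a coordinate homomorphism that kills `supp x`, so
`H` has finite rank; and then the quotient of `Hᵃᵇ` by the image of `supp x` is finitely generated
without nonzero homomorphisms to `ℤ`, hence torsion.

So let `φ` kill `supp x`, and let `y` commute with `x`. Grade `k[H]` by `φ`. As `x` is homogeneous of
degree `0`, the homogeneous components of `y` commute with `x` too. Suppose that the component `y_c`
of some degree `c ≠ 0` is nonzero. As `k[H]` is a domain (free groups have unique products), its
powers are nonzero and homogeneous of arbitrarily large degree. Let `A` be the subgroup generated by
`supp x`. For `g` of large degree, `A ∩ g A g⁻¹` is trivial (`FreeGroup.exists_conj_disjoint`). Hence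
`A g A` is a copy of `A × A`, and the restriction to it of a power of `y_c` is a nonzero element of
`k[A × A]` annihilated by `x ⊗ 1 - 1 ⊗ x*`, where `x*` is the image of `x` under inversion. As
`k[A × A]` is a domain, `x ⊗ 1 = 1 ⊗ x*`, and `x` is a scalar
(`MonoidAlgebra.eq_one_of_commute_of_conj_disjoint`), contrary to assumption.
-/

/-! ### Unique products in free groups -/

/-- A group in which every nontrivial subgroup maps nontrivially to `ℤ` has unique products. For finite
sets `A` and `B`, translated to contain `1`, such a map on the subgroup they generate is nonconstant
on one of them; a product that is unique among the elements of maximal degree is unique. -/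
theorem UniqueProds.of_exists_hom_int {G : Type*} [Group G]
    (h : ∀ K : Subgroup G, K ≠ ⊥ → ∃ φ : K →* Multiplicative ℤ, φ ≠ 1) : UniqueProds G := by
  classical
  suffices H : ∀ (n : ℕ) (A B : Finset G), A.card + B.card = n → A.Nonempty → B.Nonempty →
      ∃ a ∈ A, ∃ b ∈ B, UniqueMul A B a b from ⟨fun hA hB => H _ _ _ rfl hA hB⟩
  intro n
  induction n using Nat.strong_induction_on with
  | _ n ih =>
  rintro A B hn hA hB
  obtain ⟨a₀, ha₀⟩ := hA
  obtain ⟨b₀, hb₀⟩ := hB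
  let K : Subgroup G :=
    Subgroup.closure ((fun a => a₀⁻¹ * a) '' (A : Set G) ∪ (fun b => b * b₀⁻¹) '' (B : Set G))
  have hAK : ∀ a ∈ A, a₀⁻¹ * a ∈ K := fun a ha =>
    Subgroup.subset_closure (Or.inl ⟨a, ha, rfl⟩)
  have hBK : ∀ b ∈ B, b * b₀⁻¹ ∈ K := fun b hb =>
    Subgroup.subset_closure (Or.inr ⟨b, hb, rfl⟩)
  by_cases hK : K = ⊥
  · refine ⟨a₀, ha₀, b₀, hb₀, fun a b ha hb _ => ?_⟩
    have h1 := hAK a ha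
    have h2 := hBK b hb
    rw [hK, Subgroup.mem_bot] at h1 h2
    exact ⟨(inv_mul_eq_one.1 h1).symm, mul_inv_eq_one.1 h2⟩
  obtain ⟨φ, hφ⟩ := h K hK
  -- The degrees of the elements of the translates `a₀⁻¹ A` and `B b₀⁻¹`, extended by `0`.
  let f : G → ℤ := fun a => if h : a₀⁻¹ * a ∈ K then (φ ⟨_, h⟩).toAdd else 0
  let g : G → ℤ := fun b => if h : b * b₀⁻¹ ∈ K then (φ ⟨_, h⟩).toAdd else 0
  have hf : ∀ a (ha : a ∈ A), f a = (φ ⟨_, hAK a ha⟩).toAdd := fun a ha => dif_pos (hAK a ha)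
  have hg : ∀ b (hb : b ∈ B), g b = (φ ⟨_, hBK b hb⟩).toAdd := fun b hb => dif_pos (hBK b hb)
  have hfg : ∀ a ∈ A, ∀ b ∈ B, ∀ a' ∈ A, ∀ b' ∈ B, a * b = a' * b' → f a + g b = f a' + g b' := by
    intro a ha b hb a' ha' b' hb' e
    rw [hf a ha, hf a' ha', hg b hb, hg b' hb', ← toAdd_mul, ← toAdd_mul, ← map_mul, ← map_mul]
    congr 2
    ext
    simp only [Subgroup.coe_mul]
    rw [mul_assoc, ← mul_assoc a, e]
    group
  let A' := A.filter fun a => ∀ a' ∈ A, f a' ≤ f a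
  let B' := B.filter fun b => ∀ b' ∈ B, g b' ≤ g b
  have hA' : A'.Nonempty := by
    obtain ⟨a, ha, hmax⟩ := A.exists_max_image f ⟨a₀, ha₀⟩
    exact ⟨a, Finset.mem_filter.2 ⟨ha, hmax⟩⟩
  have hB' : B'.Nonempty := by
    obtain ⟨b, hb, hmax⟩ := B.exists_max_image g ⟨b₀, hb₀⟩
    exact ⟨b, Finset.mem_filter.2 ⟨hb, hmax⟩⟩
  have hlt : A'.card + B'.card < n := by
    have h1 : A'.card ≤ A.card := Finset.card_filter_le _ _
    have h2 : B'.card ≤ B.card := Finset.card_filter_le _ _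
    by_contra hcon
    have eA : A' = A := Finset.eq_of_subset_of_card_le (Finset.filter_subset _ _) (by omega)
    have eB : B' = B := Finset.eq_of_subset_of_card_le (Finset.filter_subset _ _) (by omega)
    -- Otherwise both degrees are constant, hence `0`, and `φ` is trivial on generators of `K`.
    have fa₀ : f a₀ = 0 := by
      rw [hf a₀ ha₀, toAdd_eq_zero]
      convert map_one φ
      simp
    have gb₀ : g b₀ = 0 := by
      rw [hg b₀ hb₀, toAdd_eq_zero]
      convert map_one φ
      simp
    have fconst : ∀ a ∈ A, f a = 0 := fun a ha => by
      rw [← fa₀]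
      exact le_antisymm ((Finset.mem_filter.1 (eA ▸ ha₀ : a₀ ∈ A')).2 a ha)
        ((Finset.mem_filter.1 (eA ▸ ha : a ∈ A')).2 a₀ ha₀)
    have gconst : ∀ b ∈ B, g b = 0 := fun b hb => by
      rw [← gb₀]
      exact le_antisymm ((Finset.mem_filter.1 (eB ▸ hb₀ : b₀ ∈ B')).2 b hb)
        ((Finset.mem_filter.1 (eB ▸ hb : b ∈ B')).2 b₀ hb₀)
    have hker : K ≤ φ.ker.map K.subtype := by
      refine (Subgroup.closure_le _).2 ?_
      rintro _ (⟨a, ha, rfl⟩ | ⟨b, hb, rfl⟩)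
      · exact ⟨⟨_, hAK a ha⟩, by
          rw [SetLike.mem_coe, MonoidHom.mem_ker, ← toAdd_eq_zero, ← hf a ha, fconst a ha], rfl⟩
      · exact ⟨⟨_, hBK b hb⟩, by
          rw [SetLike.mem_coe, MonoidHom.mem_ker, ← toAdd_eq_zero, ← hg b hb, gconst b hb], rfl⟩
    refine hφ (MonoidHom.ext fun x => ?_)
    obtain ⟨y, hy, hyx⟩ := hker x.2
    rw [← Subtype.ext hyx]
    exact hy
  obtain ⟨a, ha, b, hb, hu⟩ := ih _ hlt A' B' rfl hA' hB'
  obtain ⟨haA, hamax⟩ := Finset.mem_filter.1 ha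
  obtain ⟨hbB, hbmax⟩ := Finset.mem_filter.1 hb
  refine ⟨a, haA, b, hbB, fun a' b' ha' hb' e => ?_⟩
  have hs := hfg a' ha' b' hb' a haA b hbB e
  have h1 := hamax a' ha'
  have h2 := hbmax b' hb'
  refine hu (Finset.mem_filter.2 ⟨ha', fun x hx => ?_⟩) (Finset.mem_filter.2 ⟨hb', fun x hx => ?_⟩) e
  · have := hamax x hx
    omega
  · have := hbmax x hx
    omega

theorem IsFreeGroup.exists_hom_int_ne_one (G : Type*) [Group G] [IsFreeGroup G] [Nontrivial G] :
    ∃ φ : G →* Multiplicative ℤ, φ ≠ 1 := by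
  rcases isEmpty_or_nonempty (IsFreeGroup.Generators G) with hE | ⟨⟨x⟩⟩
  · have : Subsingleton G := (IsFreeGroup.toFreeGroup G).toEquiv.subsingleton
    exact absurd this (not_subsingleton G)
  · refine ⟨IsFreeGroup.lift fun _ => Multiplicative.ofAdd 1, fun h => ?_⟩
    have := DFunLike.congr_fun h (IsFreeGroup.of x)
    rw [IsFreeGroup.lift_of, MonoidHom.one_apply, ofAdd_eq_one] at this
    exact one_ne_zero this

/-- Free groups have unique products, since by the Nielsen–Schreier theorem every nontrivial
subgroup is free and so maps onto `ℤ`. -/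
instance IsFreeGroup.uniqueProds (G : Type*) [Group G] [IsFreeGroup G] : UniqueProds G :=
  UniqueProds.of_exists_hom_int fun K hK =>
    have := (Subgroup.nontrivial_iff_ne_bot K).2 hK
    IsFreeGroup.exists_hom_int_ne_one K

/-! ### Conjugates of a finitely generated subgroup of the kernel of a homomorphism to `ℤ` -/

namespace FreeGroup

variable {ι : Type*}

/-- The action of `ℤ` on the free group on `ι × ℤ` that shifts the second index of each letter. -/
def shift (ι : Type*) : Multiplicative ℤ →* MulAut (FreeGroup (ι × ℤ)) where
  toFun n := freeGroupCongr ((Equiv.refl ι).prodCongr (Equiv.addRight n.toAdd))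
  map_one' := by
    refine MulEquiv.toMonoidHom_injective (FreeGroup.ext_hom _ _ fun i => ?_)
    simp [freeGroupCongr]
  map_mul' m n := by
    refine MulEquiv.toMonoidHom_injective (FreeGroup.ext_hom _ _ fun i => ?_)
    simp [freeGroupCongr, Prod.map, add_left_comm, add_comm]

@[simp]
theorem shift_of (n : Multiplicative ℤ) (p : ι × ℤ) :
    shift ι n (of p) = of (p.1, p.2 + n.toAdd) := by
  simp [shift, freeGroupCongr, Prod.map]

/-- The retraction of the free group on `ι × ℤ` onto the free factor spanned by the letters
whose second index has absolute value at most `R`, killing all other letters. -/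
def truncate (ι : Type*) (R : ℕ) : FreeGroup (ι × ℤ) →* FreeGroup (ι × ℤ) :=
  lift fun p => if |p.2| ≤ R then of p else 1

theorem truncate_of (R : ℕ) (p : ι × ℤ) :
    truncate ι R (of p) = if |p.2| ≤ R then of p else 1 := lift_apply_of

theorem truncate_truncate {R R' : ℕ} (h : R ≤ R') (w : FreeGroup (ι × ℤ)) :
    truncate ι R' (truncate ι R w) = truncate ι R w := by
  have : (truncate ι R').comp (truncate ι R) = truncate ι R := by
    refine FreeGroup.ext_hom _ _ fun p => ?_
    rw [MonoidHom.comp_apply, truncate_of]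
    split_ifs with hp
    · rw [truncate_of, if_pos (hp.trans (by exact_mod_cast h))]
    · rw [_root_.map_one]
  exact DFunLike.congr_fun this w

theorem exists_truncate_eq (w : FreeGroup (ι × ℤ)) : ∃ R, truncate ι R w = w := by
  induction w using FreeGroup.induction_on with
  | C1 => exact ⟨0, _root_.map_one _⟩
  | of p => exact ⟨p.2.natAbs, by rw [truncate_of, if_pos (by simp)]⟩
  | inv_of p h => obtain ⟨R, hR⟩ := h; exact ⟨R, by rw [_root_.map_inv, hR]⟩
  | mul x y hx hy =>
    obtain ⟨R, hR⟩ := hx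
    obtain ⟨R', hR'⟩ := hy
    refine ⟨max R R', ?_⟩
    rw [_root_.map_mul, ← hR, truncate_truncate (le_max_left _ _), ← hR',
      truncate_truncate (le_max_right _ _)]

/-- A shift by more than the length of the window moves all letters of the window out of it. -/
theorem truncate_shift_truncate {R : ℕ} {n : Multiplicative ℤ} (hn : (2 * R : ℤ) < |n.toAdd|)
    (w : FreeGroup (ι × ℤ)) : truncate ι R (shift ι n (truncate ι R w)) = 1 := by
  have : ((truncate ι R).comp (shift ι n).toMonoidHom).comp (truncate ι R) = 1 := by
    refine FreeGroup.ext_hom _ _ fun p => ?_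
    rw [MonoidHom.comp_apply, truncate_of]
    split_ifs with hp
    · rw [MonoidHom.comp_apply, MulEquiv.toMonoidHom_eq_coe, MonoidHom.coe_coe, shift_of,
        truncate_of, if_neg, MonoidHom.one_apply]
      intro h
      have h1 := abs_sub (p.2 + n.toAdd) p.2
      rw [add_sub_cancel_left] at h1
      simp only at h
      omega
    · rw [_root_.map_one, MonoidHom.one_apply]
  exact DFunLike.congr_fun this w

/-- The homomorphism from the free group on `ι` that records, next to each letter, the degree
with respect to `φ` of the prefix that precedes it (for an inverse letter, of the prefix that ends
with it). The second component is `φ` itself. -/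
def heightHom (φ : FreeGroup ι →* Multiplicative ℤ) :
    FreeGroup ι →* FreeGroup (ι × ℤ) ⋊[shift ι] Multiplicative ℤ :=
  lift fun i => ⟨of (i, 0), φ (of i)⟩

theorem heightHom_right (φ : FreeGroup ι →* Multiplicative ℤ) (w : FreeGroup ι) :
    (heightHom φ w).right = φ w := by
  have : SemidirectProduct.rightHom.comp (heightHom φ) = φ :=
    FreeGroup.ext_hom _ _ fun i => by simp [heightHom]
  exact DFunLike.congr_fun this w

/-- Forgetting the recorded degrees gives back the original word. -/
theorem map_fst_heightHom_left (φ : FreeGroup ι →* Multiplicative ℤ) (w : FreeGroup ι) :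
    FreeGroup.map Prod.fst (heightHom φ w).left = w := by
  have hs : ∀ (n : Multiplicative ℤ) (x : FreeGroup (ι × ℤ)),
      FreeGroup.map Prod.fst (shift ι n x) = FreeGroup.map Prod.fst x := fun n x => by
    have : (FreeGroup.map Prod.fst).comp (shift ι n).toMonoidHom =
        FreeGroup.map (Prod.fst : ι × ℤ → ι) := FreeGroup.ext_hom _ _ fun p => by simp
    exact DFunLike.congr_fun this x
  let ψ : FreeGroup ι →* FreeGroup ι :=
    { toFun := fun w => FreeGroup.map Prod.fst (heightHom φ w).left
      map_one' := by simp
      map_mul' := fun x y => by simp [hs] }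
  have : ψ = MonoidHom.id _ := FreeGroup.ext_hom _ _ fun i => by simp [ψ, heightHom]
  exact DFunLike.congr_fun this w

/-- A finitely generated subgroup `A` of the kernel of a homomorphism `φ` from a free group to `ℤ`
meets its conjugates by elements of large degree trivially: under `heightHom`, the elements of `A`
only involve letters of bounded degree, while conjugation shifts the degrees, so a retraction onto
the letters of bounded degree fixes `A` and kills its conjugate. -/
theorem exists_conj_disjoint (φ : FreeGroup ι →* Multiplicative ℤ) {S : Set (FreeGroup ι)}
    (hS : S.Finite) (hφ : ∀ s ∈ S, φ s = 1) :
    ∃ R : ℕ, ∀ g, (R : ℤ) < |(φ g).toAdd| → ∀ a ∈ Subgroup.closure S, ∀ a' ∈ Subgroup.closure S,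
      a * g = g * a' → a = 1 := by
  obtain ⟨R, hR⟩ : ∃ R, ∀ s ∈ S, truncate ι R (heightHom φ s).left = (heightHom φ s).left := by
    choose r hr using fun s => exists_truncate_eq (heightHom φ s).left
    refine ⟨hS.toFinset.sup r, fun s hs => ?_⟩
    rw [← hr s, truncate_truncate (Finset.le_sup (hS.mem_toFinset.2 hs))]
  have hA : Subgroup.closure S ≤
      (((truncate ι R).eqLocus (MonoidHom.id _)).map SemidirectProduct.inl).comap (heightHom φ) :=
    (Subgroup.closure_le _).2 fun s hs => ⟨(heightHom φ s).left, hR s hs,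
      SemidirectProduct.ext rfl (by rw [heightHom_right, hφ s hs]; rfl)⟩
  refine ⟨2 * R, fun g hg a ha a' ha' e => ?_⟩
  obtain ⟨p, hp, hpa⟩ := hA ha
  obtain ⟨p', hp', hpa'⟩ := hA ha'
  have e' := congrArg (fun w => truncate ι R (heightHom φ w).left) e
  simp only [_root_.map_mul, ← hpa, ← hpa', SemidirectProduct.mul_left, SemidirectProduct.left_inl,
    SemidirectProduct.right_inl, _root_.map_one, MulAut.one_apply, heightHom_right] at e'
  have hp1 : truncate ι R p = p := hp
  have hp'1 : truncate ι R p' = p' := hp'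
  have h1 := truncate_shift_truncate (by exact_mod_cast hg) p'
  rw [hp'1] at h1
  rw [h1, hp1, mul_one, mul_eq_right] at e'
  have h2 := map_fst_heightHom_left φ a
  rw [← hpa, e'] at h2
  simpa using h2.symm

end FreeGroup

theorem IsFreeGroup.exists_conj_disjoint {G : Type*} [Group G] [IsFreeGroup G]
    (φ : G →* Multiplicative ℤ) {S : Set G} (hS : S.Finite) (hφ : ∀ s ∈ S, φ s = 1) :
    ∃ R : ℕ, ∀ g, (R : ℤ) < |(φ g).toAdd| → ∀ a ∈ Subgroup.closure S, ∀ a' ∈ Subgroup.closure S,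
      a * g = g * a' → a = 1 := by
  let e := IsFreeGroup.toFreeGroup G
  have hcl : ∀ a ∈ Subgroup.closure S, e a ∈ Subgroup.closure (e '' S) := fun a ha =>
    (MonoidHom.map_closure e.toMonoidHom S) ▸ Subgroup.mem_map_of_mem e.toMonoidHom ha
  obtain ⟨R, hR⟩ := FreeGroup.exists_conj_disjoint (φ.comp e.symm.toMonoidHom) (hS.image e) (by
    rintro _ ⟨s, hs, rfl⟩
    simpa using hφ s hs)
  refine ⟨R, fun g hg a ha a' ha' h => e.map_eq_one_iff.1 ?_⟩
  exact hR (e g) (by simpa using hg) (e a) (hcl a ha) (e a') (hcl a' ha') (by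
    rw [← map_mul, ← map_mul, h])

/-! ### Elements of the group algebra that commute with a homogeneous element of degree zero -/

namespace MonoidAlgebra

variable {k G : Type*} [Field k] [Group G]

/-- If `u` is supported on `A` and commutes with `w`, and some `g` in the support of `w` satisfies
`A ∩ g A g⁻¹ = 1`, then `u` is supported on `1`: the double coset `A g A` is a copy of `A × A`, on
which commuting with `u` means being annihilated by `u ⊗ 1 - 1 ⊗ u*`, where `u*` is the image of
`u` under inversion, and `k[A × A]` has no zero divisors. -/
theorem eq_one_of_commute_of_conj_disjoint [UniqueProds G] {A : Subgroup G}
    {u : MonoidAlgebra k A} {w : MonoidAlgebra k G} (huw : Commute (mapDomain A.subtype u) w)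
    {g : G} (hg : w.coeff g ≠ 0) (hA : ∀ a ∈ A, ∀ a' ∈ A, a * g = g * a' → a = 1)
    {s : A} (hs : u.coeff s ≠ 0) : s = 1 := by
  have : UniqueProds A := UniqueProds.of_injective_mulHom A.subtype.toMulHom A.subtype_injective ‹_›
  let ι : A × A → G := fun p => p.1 * g * (p.2 : G)⁻¹
  have hι : Function.Injective ι := by
    rintro ⟨a, b⟩ ⟨a', b'⟩ h
    have h' : (a : G) * g * (b : G)⁻¹ = a' * g * (b' : G)⁻¹ := h
    have e : ((a'⁻¹ * a : A) : G) * g = g * ((b'⁻¹ * b : A) : G) := by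
      push_cast
      calc (a' : G)⁻¹ * a * g = (a' : G)⁻¹ * (a * g * (b : G)⁻¹) * b := by group
        _ = g * ((b' : G)⁻¹ * b) := by rw [h']; group
    have h1 := hA _ (a'⁻¹ * a).2 _ (b'⁻¹ * b).2 e
    rw [h1, one_mul, left_eq_mul, OneMemClass.coe_eq_one] at e
    rw [OneMemClass.coe_eq_one] at h1
    exact Prod.ext (inv_mul_eq_one.1 h1).symm (inv_mul_eq_one.1 e).symm
  let W : MonoidAlgebra k (A × A) := comapDomain ι hι w
  have hW : W ≠ 0 := fun h => hg (by
    have := congrArg (fun x => x.coeff 1) h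
    simpa [W, ι] using this)
  let l : A → A × A := fun a => (a, 1)
  let r : A → A × A := fun a => (1, a⁻¹)
  have hl : Function.Injective l := fun a b h => (Prod.ext_iff.1 h).1
  have key : mapDomain l u * W = mapDomain r u * W := by
    ext ⟨a, b⟩
    have h1 := congrArg (fun x => x.coeff (ι (a, b))) huw.eq
    rw [coeff_mul_apply_left, coeff_mul_apply_right] at h1
    rw [coeff_mul_apply_left, coeff_mul_apply_left]
    simp only [mapDomain, coeff_ofCoeff] at h1 ⊢
    rw [Finsupp.sum_mapDomain_index (by simp) (by simp [add_mul]),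
      Finsupp.sum_mapDomain_index (by simp) (by simp [mul_add])] at h1
    rw [Finsupp.sum_mapDomain_index (by simp) (by simp [add_mul]),
      Finsupp.sum_mapDomain_index (by simp) (by simp [add_mul])]
    convert h1 using 3
    · simp [W, ι, l, mul_assoc]
    · ext x
      rw [mul_comm]
      simp [W, ι, r, mul_assoc]
  have hlr : mapDomain l u = mapDomain r u := mul_right_cancel₀ hW key
  have h2 : (mapDomain r u).coeff (s, 1) ≠ 0 := by
    rw [← hlr]
    change Finsupp.mapDomain l u.coeff (l s) ≠ 0
    rwa [Finsupp.mapDomain_apply hl]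
  by_contra hne
  refine h2 (Finsupp.mapDomain_of_notMem_range _ _ ?_)
  rintro ⟨t, ht⟩
  exact hne (Prod.ext_iff.1 ht).1.symm

/-- The homogeneous component of degree `c` with respect to the grading induced by `φ`. -/
noncomputable def component {C : Type*} [Group C] (φ : G →* C) (c : C) (v : MonoidAlgebra k G) :
    MonoidAlgebra k G :=
  open Classical in ofCoeff (v.coeff.filter fun g => φ g = c)

open Classical in
theorem coeff_component {C : Type*} [Group C] (φ : G →* C) (c : C) (v : MonoidAlgebra k G) (g : G) :
    (component φ c v).coeff g = if φ g = c then v.coeff g else 0 :=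
  Finsupp.filter_apply _ _ _

theorem commute_component {C : Type*} [Group C] {φ : G →* C} {u v : MonoidAlgebra k G}
    (huv : Commute u v) (hu : ∀ g, u.coeff g ≠ 0 → φ g = 1) (c : C) :
    Commute u (component φ c v) := by
  classical
  ext g
  have h1 := congrArg (fun x => x.coeff g) huv.eq
  rw [coeff_mul_apply_left, coeff_mul_apply_right] at h1 ⊢
  simp only [coeff_component]
  have hl : ∀ h ∈ u.coeff.support, φ (h⁻¹ * g) = φ g := fun h hh => by
    rw [map_mul, map_inv, hu h (Finsupp.mem_support_iff.1 hh), inv_one, one_mul]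
  have hr : ∀ h ∈ u.coeff.support, φ (g * h⁻¹) = φ g := fun h hh => by
    rw [map_mul, map_inv, hu h (Finsupp.mem_support_iff.1 hh), inv_one, mul_one]
  by_cases hc : φ g = c
  · convert h1 using 1
    · exact Finsupp.sum_congr fun h hh => by rw [hl h hh, if_pos hc]
    · exact Finsupp.sum_congr fun h hh => by rw [hr h hh, if_pos hc]
  · trans (0 : k)
    · exact Finset.sum_eq_zero fun h hh => by simp only [hl h hh, if_neg hc, mul_zero]
    · exact (Finset.sum_eq_zero fun h hh => by simp only [hr h hh, if_neg hc, zero_mul]).symm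

theorem map_eq_pow_of_coeff_pow_ne_zero {C : Type*} [Group C] {φ : G →* C} {c : C}
    {v : MonoidAlgebra k G} (hv : ∀ g, v.coeff g ≠ 0 → φ g = c) (m : ℕ) {g : G}
    (hg : (v ^ m).coeff g ≠ 0) : φ g = c ^ m := by
  classical
  induction m generalizing g with
  | zero =>
    have h1 : g = 1 := by
      by_contra hne
      refine hg ?_
      rw [pow_zero, one_def, coeff_single, Finsupp.single_eq_of_ne hne]
    rw [h1, map_one, pow_zero]
  | succ m ih =>
    rw [pow_succ] at hg
    obtain ⟨a, ha, b, hb, rfl⟩ := Finset.mem_mul.1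
      (support_coeff_mul_subset _ _ (Finsupp.mem_support_iff.2 hg))
    rw [map_mul, ih (Finsupp.mem_support_iff.1 ha), hv b (Finsupp.mem_support_iff.1 hb), pow_succ]

/-- In the group algebra of a free group, if a homomorphism to `ℤ` kills the support of a nonscalar
element, then it kills the support of everything that commutes with this element. -/
theorem map_eq_one_of_commute [IsFreeGroup G] {u v : MonoidAlgebra k G} (huv : Commute u v)
    {g₁ : G} (hg₁ : u.coeff g₁ ≠ 0) (hne : g₁ ≠ 1) (φ : G →* Multiplicative ℤ)
    (hu : ∀ g, u.coeff g ≠ 0 → φ g = 1) {g : G} (hg : v.coeff g ≠ 0) : φ g = 1 := by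
  by_contra hc
  obtain ⟨R, hR⟩ := IsFreeGroup.exists_conj_disjoint φ (S := (u.coeff.support : Set G))
    (Finset.finite_toSet _) (fun s hs => hu s (Finsupp.mem_support_iff.1 hs))
  set A := Subgroup.closure (u.coeff.support : Set G) with hA
  have hv0 : component φ (φ g) v ≠ 0 := fun h => hg (by
    classical
    have := congrArg (fun x => x.coeff g) h
    simpa [coeff_component] using this)
  -- A large power of the component of degree `φ g` is nonzero, and homogeneous of large degree.
  obtain ⟨h, hh⟩ : ∃ h, (component φ (φ g) v ^ (R + 1)).coeff h ≠ 0 := by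
    by_contra hcon
    push Not at hcon
    exact pow_ne_zero (R + 1) hv0 (MonoidAlgebra.ext (Finsupp.ext hcon))
  have hφh : φ h = φ g ^ (R + 1) := map_eq_pow_of_coeff_pow_ne_zero (fun x hx => by
    classical
    rw [coeff_component] at hx
    by_contra hne
    exact hx (if_neg hne)) _ hh
  have hlarge : (R : ℤ) < |(φ h).toAdd| := by
    rw [hφh, toAdd_pow, abs_nsmul, nsmul_eq_mul]
    have : 1 ≤ |(φ g).toAdd| := Int.one_le_abs (by simpa using hc)
    push_cast
    nlinarith
  have hsupp : (u.coeff.support : Set G) ⊆ Set.range A.subtype := fun x hx =>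
    ⟨⟨x, Subgroup.subset_closure hx⟩, rfl⟩
  have hmap := mapDomain_comapDomain hsupp A.subtype_injective
  have := eq_one_of_commute_of_conj_disjoint (A := A)
    (by rw [hmap]; exact (commute_component huv hu _).pow_right (R + 1)) hh (hR h hlarge)
    (s := ⟨g₁, Subgroup.subset_closure (Finsupp.mem_support_iff.2 hg₁)⟩)
    (by rw [coeff_comapDomain]; exact hg₁)
  exact hne (congrArg Subtype.val this)

end MonoidAlgebra

/-! ### Finite generation and rank in terms of homomorphisms to `ℤ` -/

/-- Let `S` be a finite subset of a free abelian group such that no nonzero homomorphism to `ℤ`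
kills `S`. Then the group has finite rank: coordinates in which all elements of `S` vanish would
be such homomorphisms. Moreover `S` spans a subgroup of full rank, as the quotient by the span is
a finitely generated group without nonzero homomorphism to `ℤ`. -/
theorem Module.Basis.finite_and_rank_span_eq {ι M : Type u} [AddCommGroup M] (b : Module.Basis ι ℤ M)
    {S : Set M} (hS : S.Finite) (h : ∀ f : M →ₗ[ℤ] ℤ, (∀ s ∈ S, f s = 0) → f = 0) :
    Finite ι ∧ Module.rank ℤ (Submodule.span ℤ S) = Cardinal.mk ι := by
  have hfin : Finite ι := by
    have hcover : (⋃ s ∈ S, ((b.repr s).support : Set ι)) = Set.univ := by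
      refine Set.eq_univ_of_forall fun i => ?_
      by_contra hi
      simp only [Set.mem_iUnion, Finset.mem_coe, Finsupp.mem_support_iff, not_exists,
        not_not] at hi
      have := DFunLike.congr_fun (h (b.coord i) fun s hs => hi s hs) (b i)
      simp at this
    rw [← Set.finite_univ_iff, ← hcover]
    exact hS.biUnion fun s _ => Finset.finite_toSet _
  refine ⟨hfin, ?_⟩
  have : Module.Finite ℤ M := Module.Finite.of_basis b
  have hQ : Module.rank ℤ (M ⧸ Submodule.span ℤ S) = 0 := by
    rw [rank_eq_zero_iff_isTorsion]
    let T := Submodule.torsion ℤ (M ⧸ Submodule.span ℤ S)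
    have hT : Subsingleton ((M ⧸ Submodule.span ℤ S) ⧸ T) := by
      let c := Module.Free.chooseBasis ℤ ((M ⧸ Submodule.span ℤ S) ⧸ T)
      refine ⟨fun x y => c.ext_elem fun i => ?_⟩
      have h0 := h ((c.coord i).comp (T.mkQ.comp (Submodule.span ℤ S).mkQ)) fun s hs => by
        have : (Submodule.span ℤ S).mkQ s = 0 := by
          simpa using Submodule.subset_span hs
        simp only [LinearMap.comp_apply, this, map_zero]
      have hz : ∀ z, c.repr z i = 0 := fun z => by
        obtain ⟨z, rfl⟩ := T.mkQ_surjective z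
        obtain ⟨z, rfl⟩ := (Submodule.span ℤ S).mkQ_surjective z
        exact DFunLike.congr_fun h0 z
      rw [hz, hz]
    exact (Submodule.isTorsion'_iff_torsion'_eq_top _).2 (Submodule.Quotient.subsingleton_iff.1 hT)
  rw [b.mk_eq_rank'', ← Submodule.rank_quotient_add_rank (Submodule.span ℤ S), hQ, zero_add]

/-- The abelianization of a free group is a free abelian group on the images of the generators. -/
noncomputable def IsFreeGroup.abelianizationBasis (H : Type u) [Group H] [IsFreeGroup H] :
    Module.Basis (IsFreeGroup.Generators H) ℤ (Additive (Abelianization H)) :=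
  (FreeAbelianGroup.basis _).map
    (MulEquiv.toAdditive (IsFreeGroup.mulEquiv H).abelianizationCongr).toIntLinearEquiv

theorem IsFreeGroup.fg_of_finite_generators (H : Type*) [Group H] [IsFreeGroup H]
    [Finite (IsFreeGroup.Generators H)] : Group.FG H :=
  Group.fg_of_surjective (f := (IsFreeGroup.mulEquiv H).toMonoidHom) (IsFreeGroup.mulEquiv H).surjective

theorem IsFreeGroup.fg_and_abelianGroupRank_eq {H : Type u} [Group H] [IsFreeGroup H] {S : Set H}
    (hS : S.Finite) (h : ∀ φ : H →* Multiplicative ℤ, (∀ s ∈ S, φ s = 1) → φ = 1) :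
    Group.FG H ∧
      abelianGroupRank (Subgroup.closure (Abelianization.of '' S)) = freeGroupRank H := by
  let T : Set (Additive (Abelianization H)) := (fun s => Additive.ofMul (Abelianization.of s)) '' S
  obtain ⟨hfin, hrank⟩ := (IsFreeGroup.abelianizationBasis H).finite_and_rank_span_eq
    (S := T) (hS.image _) (fun f hf => by
      have h1 := h ((AddMonoidHom.toMultiplicativeRight f.toAddMonoidHom).comp Abelianization.of)
        (fun s hs => hf _ ⟨s, hs, rfl⟩)
      ext x
      obtain ⟨x, rfl⟩ := QuotientGroup.mk_surjective x
      exact DFunLike.congr_fun h1 x)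
  refine ⟨IsFreeGroup.fg_of_finite_generators H, ?_⟩
  rw [freeGroupRank, ← hrank, abelianGroupRank]
  have hspan : Submodule.span ℤ T = AddSubgroup.toIntSubmodule
      (Subgroup.toAddSubgroup (Subgroup.closure (Abelianization.of '' S))) := by
    rw [Subgroup.toAddSubgroup_closure, AddSubgroup.toIntSubmodule_closure]
    congr 1
  rw [hspan]
  let e : Additive (Subgroup.closure (Abelianization.of '' S)) ≃+ AddSubgroup.toIntSubmodule
      (Subgroup.toAddSubgroup (Subgroup.closure (Abelianization.of '' S))) :=
    { toFun := fun x => ⟨Additive.ofMul (x.toMul : Abelianization H), x.toMul.2⟩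
      invFun := fun x => Additive.ofMul ⟨x.1.toMul, x.2⟩
      left_inv := fun _ => rfl
      right_inv := fun _ => rfl
      map_add' := fun _ _ => rfl }
  exact e.toIntLinearEquiv.rank_eq

/-! ### The centralizer-supporting group -/

theorem proposition6p2 {k : Type v} [Field k] {α : Type u} [Finite α]
    (x : MonoidAlgebra k (FreeGroup α))
    (hx : x ∉ Set.range (algebraMap k (MonoidAlgebra k (FreeGroup α)))) :
    (centralizerSupportingGroup x).FG ∧
      abelianGroupRank (Subgroup.closure (gaSuppAbImage x)) =
        freeGroupRank (centralizerSupportingGroup x) := by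
  set H := centralizerSupportingGroup x with hH
  -- An element of `k[F]` that is not a scalar has an element other than `1` in its support.
  obtain ⟨g₁, hg₁, hne⟩ : ∃ g, x.coeff g ≠ 0 ∧ g ≠ 1 := by
    by_contra! hcon
    refine hx ⟨x.coeff 1, MonoidAlgebra.ext (Finsupp.ext fun g => ?_)⟩
    rw [MonoidAlgebra.coe_algebraMap, Function.comp_apply, MonoidAlgebra.coeff_single]
    by_cases hg : g = 1
    · rw [hg, Finsupp.single_eq_same, Algebra.algebraMap_self_apply]
    · rw [Finsupp.single_eq_of_ne hg]
      exact (not_not.1 fun h => hg (hcon g h)).symm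
  let S : Set H := Subtype.val ⁻¹' gaSupp x
  have hS : S.Finite := Set.Finite.preimage Subtype.val_injective.injOn x.coeff.hasFiniteSupport
  have himage : gaSuppAbImage x = Abelianization.of '' S := by
    ext a
    constructor
    · rintro ⟨g, hg, rfl⟩
      exact ⟨⟨g, _⟩, hg, rfl⟩
    · rintro ⟨⟨g, hgH⟩, hg, rfl⟩
      exact ⟨g, hg, rfl⟩
  have hsupp : ∀ y ∈ Subalgebra.centralizer k {x}, ∀ g ∈ gaSupp y, g ∈ H := fun y hy g hg =>
    Subgroup.subset_closure (Set.mem_iUnion₂.2 ⟨y, hy, hg⟩)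
  have hlift : ∀ y ∈ Subalgebra.centralizer k {x}, MonoidAlgebra.mapDomain H.subtype
      (MonoidAlgebra.comapDomain H.subtype H.subtype_injective y) = y := fun y hy =>
    MonoidAlgebra.mapDomain_comapDomain
      (fun g hg => ⟨⟨g, hsupp y hy g (Finsupp.mem_support_iff.1 hg)⟩, rfl⟩) _
  have hxc : x ∈ Subalgebra.centralizer k {x} := by
    rw [Subalgebra.mem_centralizer_iff]
    rintro z rfl
    rfl
  have hcomm : ∀ y ∈ Subalgebra.centralizer k {x},
      Commute (MonoidAlgebra.comapDomain H.subtype H.subtype_injective x)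
        (MonoidAlgebra.comapDomain H.subtype H.subtype_injective y) := fun y hy => by
    refine MonoidAlgebra.mapDomain_injective (f := H.subtype) H.subtype_injective ?_
    rw [MonoidAlgebra.mapDomain_mul, MonoidAlgebra.mapDomain_mul, hlift x hxc, hlift y hy]
    exact (Subalgebra.mem_centralizer_iff k).1 hy x rfl
  have main : ∀ φ : H →* Multiplicative ℤ, (∀ s ∈ S, φ s = 1) → φ = 1 := by
    intro φ hφ
    have hker : H ≤ φ.ker.map H.subtype := by
      refine (Subgroup.closure_le _).2 fun g hg => ?_
      obtain ⟨y, hy, hgy⟩ := Set.mem_iUnion₂.1 hg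
      refine ⟨⟨g, hsupp y hy g hgy⟩, ?_, rfl⟩
      refine MonoidAlgebra.map_eq_one_of_commute (hcomm y hy) (g₁ := ⟨g₁, hsupp x hxc g₁ hg₁⟩)
        hg₁ (fun h => hne (congrArg Subtype.val h)) φ (fun s hs => hφ s hs) hgy
    refine MonoidHom.ext fun a => ?_
    obtain ⟨b, hb, hba⟩ := hker a.2
    rw [← Subtype.ext hba]
    exact hb
  rw [himage, ← Group.fg_iff_subgroup_fg]
  exact IsFreeGroup.fg_and_abelianGroupRank_eq hS main
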